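/- For a square complex matrix $A$ let $A^D$ be its Drazin inverse, i.e. the unique matrix $B$ with $AB=BA$, $B=BAB$ and $A^k=A^{k+1}B$ for some integer $k\ge 0$; let the index $i(A)$ be the least such $k$, and let $A^\pi=I-AA^D$. Let $E,F$ be $n\times n$ complex matrices with $EF^2=0$ and $EFE=0$, let $M=\begin{pmatrix}E&I\\F&0\end{pmatrix}$, and put $s=i(E)$, $t=i(F)$. Then $$M^D=\begin{pmatrix}\Gamma&\Delta\\ \Lambda&\Xi\end{pmatrix},$$ where (with $[x]$ the integer part of $x$, and a sum whose upper limit is less than $1$ being $0$) $$\begin{aligned} \Gamma={}&E^D+(E^D)^3F-F^DE^DF-(F^D)^2E^2E^DF-FF^DE^D+F^DEE^\pi+(F^D)^2EF\\ &-FF^D(E^D)^3F+(F^D)^3E^3E^\pi F+\sum_{i=1}^{t}F^iF^\pi(E^D)^{2i+1}+\sum_{i=1}^{[s/2]}(F^D)^{i+1}E^{2i+1}E^\pi\\ &+\sum_{i=1}^{t}F^iF^\pi(E^D)^{2i+3}F+\sum_{i=1}^{[s/2]-1}(F^D)^{i+3}E^{2i+3}E^\pi F,\\ \Delta={}&(E^D)^2+(E^D)^4F-F^D(E^D)^2F-(F^D)^2EE^DF-FF^D(E^D)^2+F^DE^\pi\\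 &-FF^D(E^D)^4F+(F^D)^3E^2E^\pi F+\sum_{i=1}^{t}F^iF^\pi(E^D)^{2i+2}+\sum_{i=1}^{[s/2]+1}(F^D)^{i+1}E^{2i}E^\pi\\ &+\sum_{i=1}^{t}F^iF^\pi(E^D)^{2i+4}F+\sum_{i=1}^{[s/2]}(F^D)^{i+3}E^{2i+2}E^\pi F,\\ \Lambda={}&FF^\pi(E^D)^2+FF^DE^\pi+FF^\pi(E^D)^4F+(F^D)^2E^2E^\pi F-FF^D(E^D)^2F-F^DEE^DF\\ &+\sum_{i=1}^{t-1}F^{i+1}F^\pi(E^D)^{2i+2}+\sum_{i=1}^{[s/2]+1}(F^D)^iE^{2i}E^\pi+\sum_{i=1}^{t-1}F^{i+1}F^\pi(E^D)^{2i+4}F\\ &+\sum_{i=1}^{[s/2]}(F^D)^{i+2}E^{2i+2}E^\pi F,\\ \Xi={}&-FF^D(E^D)^3F-F^DE^DF+FF^\pi(E^D)^3-FF^DE^D+FF^\pi(E^D)^5F-(F^D)^2E^2E^DF+(F^D)^2EF\\ &+\sum_{i=1}^{t-1}F^{i+1}F^\pi(E^D)^{2i+3}+\sum_{i=1}^{[s/2]+1}(F^D)^iE^{2i-1}E^\pi+\sum_{i=1}^{t-1}F^{i+1}F^\pi(E^D)^{2i+5}F\\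 &+\sum_{i=1}^{[s/2]}(F^D)^{i+2}E^{2i+1}E^\pi F. \end{aligned}$$ -/

import Mathlib

/-- `b` is a Drazin inverse of `a` with exponent `k`:
`a b = b a`, `b = b a b` and `a ^ k = a ^ (k + 1) b`. -/
def IsDrazinInverseWith {R : Type*} [Monoid R] (a b : R) (k : ℕ) : Prop :=
  a * b = b * a ∧ b = b * a * b ∧ a ^ k = a ^ (k + 1) * b

/-- `b` is a Drazin inverse of `a`: `a b = b a`, `b = b a b` and `a ^ k = a ^ (k + 1) b`
for some natural number `k`. -/
def IsDrazinInverse {R : Type*} [Monoid R] (a b : R) : Prop :=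
  ∃ k : ℕ, IsDrazinInverseWith a b k

/-- Every square complex matrix has a Drazin inverse. -/
theorem Matrix.exists_isDrazinInverse {m : Type*} [Fintype m] [DecidableEq m]
    (A : Matrix m m ℂ) : ∃ B : Matrix m m ℂ, IsDrazinInverse A B := by
  obtain ⟨q, hq, hX⟩ := Polynomial.exists_eq_pow_rootMultiplicity_mul_and_not_dvd
    A.charpoly A.charpoly_monic.ne_zero 0
  set k := A.charpoly.rootMultiplicity 0
  simp only [map_zero, sub_zero] at hq hX
  have hcop : IsCoprime (Polynomial.X : Polynomial ℂ) q :=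
    (Polynomial.irreducible_X.coprime_iff_not_dvd).2 hX
  obtain ⟨u, v, huv⟩ := hcop
  have h0 : Polynomial.aeval A (Polynomial.X ^ k * q) = 0 := by
    rw [← hq]; exact A.aeval_self_charpoly
  set x := Polynomial.aeval A u
  have hc : Commute A x := by
    have : Polynomial.aeval A (Polynomial.X * u) = Polynomial.aeval A (u * Polynomial.X) := by
      rw [mul_comm]
    simpa [Commute, SemiconjBy] using this
  have h1 : A ^ k = A ^ (k + 1) * x := by
    have : (Polynomial.X ^ k : Polynomial ℂ)
        = Polynomial.X ^ (k + 1) * u + v * (Polynomial.X ^ k * q) := by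
      calc (Polynomial.X ^ k : Polynomial ℂ) = Polynomial.X ^ k * (u * Polynomial.X + v * q) := by
            rw [huv, mul_one]
        _ = _ := by ring
    have h2 := congrArg (Polynomial.aeval A) this
    rw [map_add, map_mul _ v, h0, mul_zero, add_zero] at h2
    simpa using h2
  have h3 : ∀ j : ℕ, A ^ k = A ^ (k + j) * x ^ j := by
    intro j
    induction j with
    | zero => simp
    | succ j ih =>
      calc A ^ k = A ^ j * A ^ k * x ^ j := by rw [← pow_add, add_comm j k]; exact ih
        _ = A ^ j * (A ^ (k + 1) * x) * x ^ j := by rw [← h1]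
        _ = (A ^ j * A ^ (k + 1)) * (x * x ^ j) := by simp only [mul_assoc]
        _ = _ := by rw [← pow_add, ← pow_succ']; congr 2; omega
  have hB : Commute A (A ^ k * x ^ (k + 1)) :=
    ((Commute.refl A).pow_right k).mul_right (hc.pow_right _)
  have e1 : A ^ (k + 1) * (A ^ k * x ^ (k + 1)) = A ^ k := by
    rw [← mul_assoc, ← pow_add, h3 (k + 1)]
    congr 2
    omega
  refine ⟨A ^ k * x ^ (k + 1), k, hB, ?_, e1.symm⟩
  have hxk : Commute (x ^ (k + 1)) (A ^ (k + 1)) := (hc.symm.pow_left _).pow_right _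
  calc A ^ k * x ^ (k + 1) = A ^ (k + 1) * (A ^ k * x ^ (k + 1)) * x ^ (k + 1) := by rw [e1]
    _ = (A ^ k * x ^ (k + 1)) * A ^ (k + 1) * x ^ (k + 1) := by
        rw [(hB.pow_left (k + 1)).eq]
    _ = _ := by rw [pow_succ' A k]; simp only [mul_assoc]

/-- A Drazin inverse is unique. -/
theorem IsDrazinInverse.eq {R : Type*} [Monoid R] {a b c : R}
    (hb : IsDrazinInverse a b) (hc : IsDrazinInverse a c) : b = c := by
  obtain ⟨k, hb1, hb2, hb3⟩ := hb
  obtain ⟨l, hc1, hc2, hc3⟩ := hc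
  have up : ∀ {d : R} {k : ℕ}, a ^ k = a ^ (k + 1) * d → a * d = d * a →
      ∀ j, a ^ (k + j) = a ^ (k + j + 1) * d := by
    intro d k h h1 j
    calc a ^ (k + j) = a ^ j * a ^ k := by rw [← pow_add, add_comm]
      _ = a ^ j * (a ^ (k + 1) * d) := by rw [← h]
      _ = a ^ (k + j + 1) * d := by rw [← mul_assoc, ← pow_add]; congr 2; omega
  have pows : ∀ {d : R}, d = d * a * d → a * d = d * a → ∀ j, d = d ^ (j + 1) * a ^ j := by
    intro d h h1 j
    induction j with
    | zero => simp
    | succ j ih =>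
      have hcm : Commute a d := h1
      calc d = d * a * d := h
        _ = d * d * a := by rw [mul_assoc, h1, mul_assoc]
        _ = d * (d ^ (j + 1) * a ^ j) * a := by rw [← ih]
        _ = _ := by rw [pow_succ' d (j + 1), pow_succ a j]; simp only [mul_assoc]
  have hcb : Commute a b := hb1
  have hcc : Commute a c := hc1
  have eb := up hb3 hb1 l
  have ec := up hc3 hc1 k
  rw [add_comm l k] at ec
  have key1 : b = b * a * c := by
    have h := pows hb2 hb1 (k + l)
    calc b = b ^ (k + l + 1) * a ^ (k + l) := h
      _ = b ^ (k + l + 1) * (a ^ (k + l + 1) * c) := by rw [← ec]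
      _ = (b ^ (k + l + 1) * a ^ (k + l)) * a * c := by
          rw [pow_succ a]; simp only [mul_assoc]
      _ = b * a * c := by rw [← h]
  have key2 : c = b * a * c := by
    have h := pows hc2 hc1 (k + l)
    have h' : c = a ^ (k + l) * c ^ (k + l + 1) := by
      rw [(hcc.pow_pow (k + l) (k + l + 1)).eq]; exact h
    calc c = a ^ (k + l) * c ^ (k + l + 1) := h'
      _ = (a ^ (k + l + 1) * b) * c ^ (k + l + 1) := by rw [← eb]
      _ = b * a * (a ^ (k + l) * c ^ (k + l + 1)) := by
          rw [(hcb.pow_left (k + l + 1)).eq, pow_succ' a]; simp only [mul_assoc]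
      _ = b * a * c := by rw [← h']
  rw [key1, ← key2]

/-- The Drazin inverse `A^D` of a square complex matrix. -/
noncomputable def Matrix.drazinInv {m : Type*} [Fintype m] [DecidableEq m]
    (A : Matrix m m ℂ) : Matrix m m ℂ :=
  A.exists_isDrazinInverse.choose

/-- The Drazin index `i(A)` of a square complex matrix: the least natural number `k`
with `A ^ k = A ^ (k + 1) A^D` (it is `0` exactly when `A` is invertible). -/
noncomputable def Matrix.drazinIndex {m : Type*} [Fintype m] [DecidableEq m]
    (A : Matrix m m ℂ) : ℕ :=
  sInf {k : ℕ | IsDrazinInverseWith A A.drazinInv k}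

/-- The spectral idempotent `A^π = I - A A^D`. -/
noncomputable def Matrix.drazinPi {m : Type*} [Fintype m] [DecidableEq m]
    (A : Matrix m m ℂ) : Matrix m m ℂ :=
  1 - A * A.drazinInv

/-- `A.drazinInv` is the Drazin inverse of `A`. -/
theorem Matrix.isDrazinInverse_drazinInv {m : Type*} [Fintype m] [DecidableEq m]
    (A : Matrix m m ℂ) : IsDrazinInverse A A.drazinInv :=
  A.exists_isDrazinInverse.choose_spec

/-! By uniqueness of Drazin inverses it is enough to exhibit one for `M`. Everything is built from a
single matrix `W`, the `coupling`: it is the off-diagonal block of the Drazin inverse of the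
triangular matrix with rows `(F, I)` and `(0, E²)`. For that triangular matrix, commuting with its
Drazin inverse amounts to `coupling_mul_sq_sub`, and the identity `B = BAB` to `coupling_eq`. The
hypotheses `EF² = 0` and `EFE = 0` annihilate almost every term of `W` in a product, leaving `EW =
(E^D)³`, `EFW = 0`, `WF² = FF^D` and `WFE = F^D E`.

The candidate `X` has top row `(W(E³ + EF) + F^D E, W(E² + F))`; commuting with `M` forces its
bottom row, so `X = XMX` need only be checked on the top row. For the power condition, the block
columns of `M^k (1 - MX)` are killed by `X` and obey a two-term recurrence, which makes them vanish
for large `k` (`recurrence_eventually_zero`). These facts form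
`isDrazinInverse_fromBlocks_of_coupling`. Expanding `W` and discarding terms that contain a high
power of `E` times `E^π`, or of `F` times `F^π`, then gives the stated sums. -/

section Coupling

/-! ### The coupling term and its identities. -/

variable {R : Type*} [Ring R] {e f d g : R} {s t : ℕ}

theorem IsDrazinInverseWith.pow_add_mul_one_sub {a b : R} {k : ℕ} (h : IsDrazinInverseWith a b k)
    (j : ℕ) : a ^ (k + j) * (1 - a * b) = 0 := by
  obtain ⟨-, -, h3⟩ := h
  have : a ^ k * (1 - a * b) = 0 := by
    rw [mul_sub, mul_one, ← mul_assoc, ← pow_succ, ← h3, sub_self]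
  rw [add_comm, pow_add, mul_assoc, this, mul_zero]

theorem IsDrazinInverseWith.pow_mul_one_sub {a b : R} {k m : ℕ} (h : IsDrazinInverseWith a b k)
    (hm : k ≤ m) : a ^ m * (1 - a * b) = 0 := by
  obtain ⟨j, rfl⟩ := Nat.exists_eq_add_of_le hm
  exact h.pow_add_mul_one_sub j

theorem IsDrazinInverseWith.inv_eq_mul_sq {a b : R} {k : ℕ} (h : IsDrazinInverseWith a b k) :
    a * b ^ 2 = b := by
  rw [sq, ← mul_assoc, h.1, ← h.2.1]

theorem IsDrazinInverseWith.inv_eq_sq_mul {a b : R} {k : ℕ} (h : IsDrazinInverseWith a b k) :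
    b ^ 2 * a = b := by
  rw [sq, mul_assoc, ← h.1, ← mul_assoc, ← h.2.1]

theorem IsDrazinInverseWith.mul_inv_pow {a b : R} {k : ℕ} (h : IsDrazinInverseWith a b k) (j : ℕ) :
    a * b ^ (j + 2) = b ^ (j + 1) := by
  rw [add_comm j 2, pow_add, ← mul_assoc, h.inv_eq_mul_sq, ← pow_succ']

theorem IsDrazinInverseWith.inv_pow_mul {a b : R} {k : ℕ} (h : IsDrazinInverseWith a b k) (j : ℕ) :
    b ^ (j + 2) * a = b ^ (j + 1) := by
  rw [pow_add, mul_assoc, h.inv_eq_sq_mul, ← pow_succ]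

theorem IsDrazinInverseWith.inv_mul_one_sub {a b : R} {k : ℕ} (h : IsDrazinInverseWith a b k) :
    b * (1 - a * b) = 0 := by
  rw [mul_sub, mul_one, ← mul_assoc, ← h.2.1, sub_self]

theorem IsDrazinInverseWith.one_sub_mul_inv {a b : R} {k : ℕ} (h : IsDrazinInverseWith a b k) :
    (1 - a * b) * b = 0 := by
  rw [sub_mul, one_mul, h.1, ← h.2.1, sub_self]

theorem IsDrazinInverseWith.commute_one_sub {a b : R} {k : ℕ} (h : IsDrazinInverseWith a b k) :
    Commute a (1 - a * b) :=
  (Commute.one_right a).sub_right ((Commute.refl a).mul_right h.1)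

/-- The inverse `g` is left divisible by `f ^ 2`, since `g = f ^ 2 * g ^ 3`. -/
theorem mul_inv_eq_zero_of_mul_sq (hf : IsDrazinInverseWith f g t) (h₁ : e * f ^ 2 = 0) :
    e * g = 0 := by
  have h0 := hf.inv_eq_mul_sq
  have : g = f ^ 2 * g ^ 3 := by
    calc g = f * (g * g) := by rw [← sq, h0]
      _ = f * ((f * g ^ 2) * g) := by rw [h0]
      _ = _ := by noncomm_ring
  rw [this, ← mul_assoc, h₁, zero_mul]

/-- The part `∑ fⁱ (1 - f g) d ^ (2 i + j)` of the coupling term. -/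
def couplingLeft (f g d : R) (t j : ℕ) : R :=
  ∑ i ∈ Finset.range (t + 1), f ^ i * (1 - f * g) * d ^ (2 * i + j)

/-- The part `∑ g ^ (i + 2) e ^ (2 i + j) (1 - e d)` of the coupling term. -/
def couplingRight (e d g : R) (s j : ℕ) : R :=
  ∑ i ∈ Finset.range (s / 2 + 1), g ^ (i + 2) * e ^ (2 * i + j) * (1 - e * d)

/-- A solution `w` of `w e ^ 2 - f w = d ^ 2 - g`, for `d`, `g` Drazin inverses of `e`, `f`. -/
def coupling (e f d g : R) (s t : ℕ) : R :=
  couplingLeft f g d t 4 - g * d ^ 2 + couplingRight e d g s 0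

theorem couplingLeft_mul (he : IsDrazinInverseWith e d s) (j : ℕ) :
    couplingLeft f g d t (j + 2) * e = couplingLeft f g d t (j + 1) := by
  simp only [couplingLeft, Finset.sum_mul]
  refine Finset.sum_congr rfl fun i _ => ?_
  rw [mul_assoc, show 2 * i + (j + 2) = 2 * i + j + 2 by ring, he.inv_pow_mul]
  rfl

theorem couplingRight_mul (he : IsDrazinInverseWith e d s) (j : ℕ) :
    couplingRight e d g s j * e = couplingRight e d g s (j + 1) := by
  simp only [couplingRight, Finset.sum_mul]
  refine Finset.sum_congr rfl fun i _ => ?_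
  rw [mul_assoc, ← he.commute_one_sub.eq, ← mul_assoc, mul_assoc (g ^ (i + 2)), ← pow_succ]
  rfl

theorem mul_mul_couplingRight (hf : IsDrazinInverseWith f g t) (j : ℕ) :
    f * g * couplingRight e d g s j = couplingRight e d g s j := by
  rw [couplingRight, Finset.mul_sum]
  refine Finset.sum_congr rfl fun i _ => ?_
  rw [← mul_assoc, ← mul_assoc, mul_assoc f g, ← pow_succ',
    show i + 2 + 1 = i + 1 + 2 by ring, hf.mul_inv_pow (i + 1)]

/-- As `e * g = 0`, only the sum with powers of `f` on the left can contribute, and there only `i =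
0` survives: `i = 1` dies by `e * f * e = 0`, all later terms by `e * f ^ 2 = 0`. -/
theorem mul_coupling (he : IsDrazinInverseWith e d s) (hf : IsDrazinInverseWith f g t)
    (h₁ : e * f ^ 2 = 0) (h₂ : e * f * e = 0) : e * coupling e f d g s t = d ^ 3 := by
  have hg : e * g = 0 := mul_inv_eq_zero_of_mul_sq hf h₁
  have hL : e * couplingLeft f g d t 4 = d ^ 3 := by
    rw [couplingLeft, Finset.sum_range_succ', mul_add, Finset.mul_sum, Finset.sum_eq_zero, zero_add]
    · have : e * (1 - f * g) = e := by
        rw [hf.1, mul_sub, ← mul_assoc, hg, zero_mul, mul_one, sub_zero]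
      rw [pow_zero, one_mul, ← mul_assoc, this]
      exact he.mul_inv_pow 2
    · intro i _
      rcases i with _ | i
      · have h3 : e * f * (1 - f * g) = e * f := by
          rw [mul_sub, mul_one, mul_assoc e f, ← mul_assoc f f, ← sq, ← mul_assoc e, h₁, zero_mul,
            sub_zero]
        rw [zero_add, pow_one, ← mul_assoc, ← mul_assoc, h3, ← he.mul_inv_pow, ← mul_assoc, h₂,
          zero_mul]
      · rw [show i + 1 + 1 = 2 + i by ring, pow_add, ← mul_assoc, ← mul_assoc, ← mul_assoc, h₁]
        simp
  have hR : e * couplingRight e d g s 0 = 0 := by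
    rw [couplingRight, Finset.mul_sum]
    refine Finset.sum_eq_zero fun i _ => ?_
    rw [show i + 2 = i + 1 + 1 by ring, pow_succ', ← mul_assoc, ← mul_assoc, ← mul_assoc, hg]
    simp
  rw [coupling, mul_add, mul_sub, hL, hR, ← mul_assoc, hg, zero_mul, sub_zero, add_zero]

theorem mul_mul_coupling (he : IsDrazinInverseWith e d s) (hf : IsDrazinInverseWith f g t)
    (h₁ : e * f ^ 2 = 0) (h₂ : e * f * e = 0) : e * f * coupling e f d g s t = 0 := by
  have hg : e * f * g = 0 := by
    rw [mul_assoc, hf.1, ← mul_assoc, mul_inv_eq_zero_of_mul_sq hf h₁, zero_mul]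
  have hd : ∀ j, e * f * d ^ (j + 1) = 0 := fun j => by
    rw [← he.mul_inv_pow, ← mul_assoc, h₂, zero_mul]
  have hL : e * f * couplingLeft f g d t 4 = 0 := by
    rw [couplingLeft, Finset.mul_sum]
    refine Finset.sum_eq_zero fun i _ => ?_
    rcases i with _ | i
    · rw [pow_zero, one_mul, ← mul_assoc, hf.1, mul_sub, mul_one, ← mul_assoc, hg, zero_mul,
        sub_zero]
      exact hd 3
    · have : e * f * f ^ (i + 1) = 0 := by
        rw [mul_assoc, ← pow_succ', add_assoc, add_comm i, pow_add, ← mul_assoc, h₁, zero_mul]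
      rw [← mul_assoc, ← mul_assoc, this, zero_mul, zero_mul]
  have hR : e * f * couplingRight e d g s 0 = 0 := by
    rw [couplingRight, Finset.mul_sum]
    refine Finset.sum_eq_zero fun i _ => ?_
    rw [show i + 2 = i + 1 + 1 by ring, pow_succ', ← mul_assoc, ← mul_assoc, ← mul_assoc, hg]
    simp
  rw [coupling, mul_add, mul_sub, hL, hR, ← mul_assoc, hg, zero_mul, sub_zero, add_zero]

/-- Any term with a factor `d` or `e` next to `f ^ 2` vanishes, which leaves the `i = 0` term `g ^ 2
* f ^ 2` of `couplingRight`. The next lemma has the same mechanism with `f * e` in place of `f ^ 2`.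
-/
theorem coupling_mul_sq (he : IsDrazinInverseWith e d s) (hf : IsDrazinInverseWith f g t)
    (h₁ : e * f ^ 2 = 0) : coupling e f d g s t * f ^ 2 = f * g := by
  have hd : ∀ j, d ^ (j + 1) * f ^ 2 = 0 := fun j => by
    rw [← he.inv_pow_mul, mul_assoc, h₁, mul_zero]
  have hL : couplingLeft f g d t 4 * f ^ 2 = 0 := by
    rw [couplingLeft, Finset.sum_mul]
    refine Finset.sum_eq_zero fun i _ => ?_
    rw [mul_assoc, show 2 * i + 4 = 2 * i + 3 + 1 by ring, hd, mul_zero]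
  have hp : (1 - e * d) * f ^ 2 = f ^ 2 := by
    rw [he.1, sub_mul, mul_assoc, h₁, mul_zero, one_mul, sub_zero]
  have hR : couplingRight e d g s 0 * f ^ 2 = f * g := by
    rw [couplingRight, Finset.sum_mul, Finset.sum_range_succ', Finset.sum_eq_zero]
    · rw [mul_assoc, hp, zero_add]
      simp only [zero_add, mul_zero, pow_zero, mul_one]
      rw [sq f, ← mul_assoc, hf.inv_eq_sq_mul, hf.1]
    · intro i _
      rw [mul_assoc, hp, show 2 * (i + 1) + 0 = 2 * i + 1 + 1 by ring, pow_succ e, mul_assoc,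
        mul_assoc, h₁]
      simp
  rw [coupling, add_mul, sub_mul, hL, hR, mul_assoc, hd 1, mul_zero, sub_zero, zero_add]

theorem coupling_mul_mul (he : IsDrazinInverseWith e d s) (hf : IsDrazinInverseWith f g t)
    (h₂ : e * f * e = 0) : coupling e f d g s t * (f * e) = g * e := by
  have h₂' : e * (f * e) = 0 := by rw [← mul_assoc, h₂]
  have hd : ∀ j, d ^ (j + 1) * (f * e) = 0 := fun j => by
    rw [← he.inv_pow_mul, mul_assoc, h₂', mul_zero]
  have hL : couplingLeft f g d t 4 * (f * e) = 0 := by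
    rw [couplingLeft, Finset.sum_mul]
    refine Finset.sum_eq_zero fun i _ => ?_
    rw [mul_assoc, show 2 * i + 4 = 2 * i + 3 + 1 by ring, hd, mul_zero]
  have hp : (1 - e * d) * (f * e) = f * e := by
    rw [he.1, sub_mul, mul_assoc, h₂', mul_zero, one_mul, sub_zero]
  have hR : couplingRight e d g s 0 * (f * e) = g * e := by
    rw [couplingRight, Finset.sum_mul, Finset.sum_range_succ', Finset.sum_eq_zero]
    · rw [mul_assoc, hp, zero_add]
      simp only [zero_add, mul_zero, pow_zero, mul_one]
      rw [← mul_assoc, hf.inv_eq_sq_mul]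
    · intro i _
      rw [mul_assoc, hp, show 2 * (i + 1) + 0 = 2 * i + 1 + 1 by ring, pow_succ e, mul_assoc,
        mul_assoc, h₂']
      simp
  rw [coupling, add_mul, sub_mul, hL, hR, mul_assoc, hd 1, mul_zero, sub_zero, zero_add]

/-- Both sums telescope: multiplying by `e ^ 2` on the right and by `f` on the left gives the same
sum shifted by one index. One boundary term remains in each; the other is zero because it carries `f
^ (t + 1) * (1 - f * g)` or a power of `e` at least `s` times `1 - e * d`. -/
theorem coupling_mul_sq_sub (he : IsDrazinInverseWith e d s) (hf : IsDrazinInverseWith f g t) :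
    coupling e f d g s t * e ^ 2 - f * coupling e f d g s t = d ^ 2 - g := by
  have hL : couplingLeft f g d t 4 * e ^ 2 - f * couplingLeft f g d t 4 = (1 - f * g) * d ^ 2 := by
    rw [sq, ← mul_assoc, couplingLeft_mul he 2, couplingLeft_mul he 1, couplingLeft, couplingLeft,
      Finset.sum_range_succ', Finset.sum_range_succ, mul_add, ← mul_assoc f, ← mul_assoc f,
      ← pow_succ', hf.pow_mul_one_sub (Nat.le_succ t), zero_mul, add_zero, Finset.mul_sum]
    simp only [← mul_assoc, ← pow_succ']
    have : ∀ i, 2 * (i + 1) + (1 + 1) = 2 * i + 4 := fun i => by ring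
    simp only [this]
    simp
  have hR : couplingRight e d g s 0 * e ^ 2 - f * couplingRight e d g s 0
      = - (g * (1 - e * d)) := by
    have hz : ∀ j, s ≤ j → ∀ x, x * e ^ j * (1 - e * d) = 0 := fun j hj x => by
      rw [mul_assoc, he.pow_mul_one_sub hj, mul_zero]
    rw [sq, ← mul_assoc, couplingRight_mul he, couplingRight_mul he, couplingRight, couplingRight,
      Finset.sum_range_succ, Finset.sum_range_succ', hz _ (by omega), add_zero, mul_add,
      Finset.mul_sum]
    simp only [← mul_assoc, hf.mul_inv_pow]
    have : ∀ i, 2 * (i + 1) + 0 = 2 * i + (0 + 1 + 1) := fun i => by ring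
    simp only [this, add_assoc]
    simp
  have hM : g * d ^ 2 * e ^ 2 - f * (g * d ^ 2) = g * e * d - f * g * d ^ 2 := by
    have : d ^ 2 * e ^ 2 = e * d := by
      rw [sq e, ← mul_assoc, he.inv_eq_sq_mul, he.1]
    rw [mul_assoc, this]
    noncomm_ring
  calc _ = (couplingLeft f g d t 4 * e ^ 2 - f * couplingLeft f g d t 4)
        - (g * d ^ 2 * e ^ 2 - f * (g * d ^ 2))
        + (couplingRight e d g s 0 * e ^ 2 - f * couplingRight e d g s 0) := by
        rw [coupling]; noncomm_ring
    _ = _ := by rw [hL, hM, hR]; noncomm_ring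

/-- The idempotent `e * d` on the right fixes `couplingLeft` and kills `couplingRight`; `f * g` on
the left does the opposite. Both fix `g * d ^ 2`, which is thus counted twice with a minus sign, and
the last summand corrects this. -/
theorem coupling_eq (he : IsDrazinInverseWith e d s) (hf : IsDrazinInverseWith f g t) :
    coupling e f d g s t = coupling e f d g s t * e * d + f * g * coupling e f d g s t
      + g * d ^ 2 := by
  have h1 : couplingLeft f g d t 4 * e * d = couplingLeft f g d t 4 := by
    rw [couplingLeft, Finset.sum_mul, Finset.sum_mul]
    refine Finset.sum_congr rfl fun i _ => ?_
    rw [mul_assoc, mul_assoc, ← mul_assoc _ e d, show 2 * i + 4 = 2 * i + 2 + 2 by ring,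
      he.inv_pow_mul, ← pow_succ]
  have h2 : f * g * couplingLeft f g d t 4 = 0 := by
    rw [couplingLeft, Finset.mul_sum]
    refine Finset.sum_eq_zero fun i _ => ?_
    rw [(hf.commute_one_sub.pow_left i).eq, mul_assoc f g, ← mul_assoc g, ← mul_assoc g,
      hf.inv_mul_one_sub]
    simp
  have h3 : couplingRight e d g s 0 * e * d = 0 := by
    rw [couplingRight_mul he, couplingRight, Finset.sum_mul]
    refine Finset.sum_eq_zero fun i _ => ?_
    rw [mul_assoc, he.one_sub_mul_inv, mul_zero]
  have h4 : f * g * couplingRight e d g s 0 = couplingRight e d g s 0 :=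
    mul_mul_couplingRight hf 0
  have h5 : g * d ^ 2 * e * d = g * d ^ 2 := by
    rw [mul_assoc g, he.inv_eq_sq_mul, mul_assoc, sq]
  have h6 : f * g * (g * d ^ 2) = g * d ^ 2 := by
    rw [← mul_assoc, mul_assoc f, ← sq, hf.inv_eq_mul_sq]
  rw [coupling]
  simp only [add_mul, sub_mul, mul_add, mul_sub, h1, h2, h3, h4, h5, h6]
  abel

end Coupling

/-! ### Vanishing of the columns killed by the candidate inverse. -/

section Recurrence

variable {R : Type*} [Ring R] {e f d g w : R} {s t : ℕ} {x y : ℕ → R}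

/-- Here `(x k, y k)` is a block column of `M ^ k * (1 - M * X)`, and `h` says that the top row of
`X` kills it. The hypothesis `h` yields `e * d * x 3 = 0`, so `e * x k` dies after about `s` steps.
From then on `x (k + 2) = f * x k`, while `h` gives `f * g * x k = 0`, so about `2 * t` further
steps finish. -/
theorem recurrence_eventually_zero (he : IsDrazinInverseWith e d s)
    (hf : IsDrazinInverseWith f g t) (h₁ : e * f ^ 2 = 0) (h₂ : e * f * e = 0)
    (hw : e * w = d ^ 3) (hw2 : w * f ^ 2 = f * g)
    (hx : ∀ k, x (k + 1) = e * x k + y k) (hy : ∀ k, y (k + 1) = f * x k)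
    (h : ∀ k, (w * (e ^ 3 + e * f) + g * e) * x k + w * (e ^ 2 + f) * y k = 0) :
    x (s + 2 * t + 4) = 0 ∧ y (s + 2 * t + 4) = 0 := by
  have hx2 : ∀ k, x (k + 2) = e * x (k + 1) + f * x k := fun k => by rw [hx (k + 1), hy]
  have hef : ∀ k, e * f * x (k + 2) = 0 := fun k => by
    rw [hx2, mul_add, ← mul_assoc, h₂, ← mul_assoc, mul_assoc e, ← sq, h₁]
    simp
  have hdf : ∀ k, d * f * x (k + 2) = 0 := fun k => by
    rw [← he.inv_eq_sq_mul, mul_assoc, mul_assoc, ← mul_assoc e, hef, mul_zero]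
  have hdff : ∀ k, d * f * (f * x k) = 0 := fun k => by
    rw [← he.inv_eq_sq_mul, ← mul_assoc, mul_assoc _ f f, mul_assoc (d ^ 2), ← sq, h₁]
    simp
  have hstep : ∀ k, e * x (k + 4) = e ^ 2 * x (k + 3) := fun k => by
    rw [hx2 (k + 2), mul_add, ← mul_assoc e f, hef, add_zero, ← mul_assoc, ← sq]
  have hiter : ∀ j, e * x (j + 3) = e ^ (j + 1) * x 3 := fun j => by
    induction j with
    | zero => simp
    | succ j ih =>
      rw [show j + 1 + 3 = j + 4 by ring, hstep, sq, mul_assoc, ih, ← mul_assoc, ← pow_succ']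
  have heg : e * g = 0 := mul_inv_eq_zero_of_mul_sq hf h₁
  -- Multiplying `h 3` by `e` turns `w` into `d ^ 3` and removes `g`; every surviving term but `e *
  -- d * x 3` contains `d * f` applied to something it kills.
  have hed : e * d * x 3 = 0 := by
    have h0 := congrArg (e * ·) (h 3)
    simp only [mul_zero] at h0
    have a1 : d ^ 3 * e ^ 3 = e * d := by
      have : d ^ 3 * e ^ 3 = d * (d ^ 2 * e) * e * e := by noncomm_ring
      rw [this, he.inv_eq_sq_mul, ← sq, he.inv_eq_sq_mul, he.1]
    have a2 : d ^ 3 * e = d ^ 2 := he.inv_pow_mul 1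
    have a3 : d ^ 3 * e ^ 2 = d := by rw [sq, ← mul_assoc, a2, he.inv_eq_sq_mul]
    have h4 : e * ((w * (e ^ 3 + e * f) + g * e) * x 3 + w * (e ^ 2 + f) * y 3)
        = (d ^ 3 * e ^ 3) * x 3 + d ^ 3 * e * f * x 3
          + (d ^ 3 * e ^ 2 * (f * x 2) + d ^ 3 * (f * (f * x 2))) := by
      have : e * ((w * (e ^ 3 + e * f) + g * e) * x 3 + w * (e ^ 2 + f) * y 3)
          = e * w * ((e ^ 3 + e * f) * x 3 + (e ^ 2 + f) * y 3) + e * g * (e * x 3) := by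
        noncomm_ring
      rw [this, hw, heg, hy 2]
      noncomm_ring
    rw [h4, a1, a2, a3] at h0
    have b1 : d ^ 2 * f * x 3 = 0 := by rw [sq, mul_assoc, mul_assoc, ← mul_assoc d f, hdf, mul_zero]
    have b2 : d * (f * x 2) = 0 := by rw [← mul_assoc]; exact hdf 0
    have b3 : d ^ 3 * (f * (f * x 2)) = 0 := by
      rw [pow_succ, mul_assoc, ← mul_assoc d f, hdff, mul_zero]
    simpa [b1, b2, b3] using h0
  have hez : ∀ j, e * x (s + 3 + j) = 0 := fun j => by
    rw [show s + 3 + j = s + j + 3 by ring, hiter]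
    have : e ^ (s + j + 1) * (1 - e * d) * x 3 = 0 := by
      rw [he.pow_mul_one_sub (by omega), zero_mul]
    rw [mul_assoc, sub_mul, one_mul, hed, sub_zero] at this
    exact this
  have hfg : ∀ i, f * g * x (s + 3 + i) = 0 := fun i => by
    have h0 := h (s + 3 + i + 1)
    rw [hy] at h0
    have h4 : (w * (e ^ 3 + e * f) + g * e) * x (s + 3 + i + 1)
          + w * (e ^ 2 + f) * (f * x (s + 3 + i))
        = w * e ^ 2 * (e * x (s + 3 + i + 1)) + w * (e * f * x (s + 3 + i + 1))
          + g * (e * x (s + 3 + i + 1)) + w * e * (e * f * x (s + 3 + i))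
          + w * f ^ 2 * x (s + 3 + i) := by
      noncomm_ring
    have c1 : e * f * x (s + 3 + i + 1) = 0 := by
      rw [show s + 3 + i + 1 = s + i + 2 + 2 by ring, hef]
    have c2 : e * f * x (s + 3 + i) = 0 := by
      rw [show s + 3 + i = s + i + 1 + 2 by ring, hef]
    have c3 : e * x (s + 3 + i + 1) = 0 := hez (i + 1)
    rw [h4, c3, c1, c2, hw2] at h0
    simpa using h0
  have hpow : ∀ i j, x (s + 3 + i + 2 * j) = f ^ j * x (s + 3 + i) := fun i j => by
    induction j with
    | zero => simp
    | succ j ih =>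
      rw [show s + 3 + i + 2 * (j + 1) = s + 3 + i + 2 * j + 2 by ring, hx2,
        show s + 3 + i + 2 * j + 1 = s + 3 + (i + 2 * j + 1) by ring, hez, ih, zero_add,
        ← mul_assoc, ← pow_succ']
  have hxz : ∀ i, x (s + 3 + i + 2 * t) = 0 := fun i => by
    have : f ^ t * (1 - f * g) * x (s + 3 + i) = 0 := by
      rw [hf.pow_mul_one_sub le_rfl, zero_mul]
    rw [mul_assoc, sub_mul, one_mul, hfg, sub_zero] at this
    rw [hpow, this]
  constructor
  · rw [← hxz 1]
    congr 1
    ring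
  · rw [show s + 2 * t + 4 = s + 3 + 0 + 2 * t + 1 by ring, hy, hxz, mul_zero]

end Recurrence

/-! ### The block candidate is a Drazin inverse. -/

section Blocks

open Matrix

variable {m : Type*} [Fintype m] [DecidableEq m]

/-- A matrix commuting with `fromBlocks e 1 f 0` is determined by its top block row. -/
theorem fromBlocks_eq_of_commute {e f a b c d c' d' : Matrix m m ℂ}
    (h : Commute (fromBlocks e 1 f 0) (fromBlocks a b c d))
    (h' : Commute (fromBlocks e 1 f 0) (fromBlocks a b c' d')) :
    fromBlocks a b c d = fromBlocks a b c' d' := by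
  have key : ∀ {c d : Matrix m m ℂ}, Commute (fromBlocks e 1 f 0) (fromBlocks a b c d) →
      c = a * e + b * f - e * a ∧ d = a - e * b := by
    intro c d h
    have h1 := h.eq
    rw [fromBlocks_multiply, fromBlocks_multiply, fromBlocks_inj] at h1
    simp only [one_mul, mul_one, mul_zero, add_zero] at h1
    exact ⟨eq_sub_of_add_eq' h1.1, eq_sub_of_add_eq' h1.2.1⟩
  rw [(key h).1, (key h).2, (key h').1, (key h').2]

theorem isDrazinInverse_fromBlocks_of_coupling {E F D G W : Matrix m m ℂ} {s t : ℕ}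
    (he : IsDrazinInverseWith E D s) (hf : IsDrazinInverseWith F G t)
    (h₁ : E * F ^ 2 = 0) (h₂ : E * F * E = 0)
    (hw : E * W = D ^ 3) (hefw : E * F * W = 0) (hw2 : W * F ^ 2 = F * G)
    (hw3 : W * (F * E) = G * E)
    (hsyl : W * E ^ 2 - F * W = D ^ 2 - G) (hW : W = W * E * D + F * G * W + G * D ^ 2) :
    IsDrazinInverse (fromBlocks E 1 F 0)
      (fromBlocks (W * (E ^ 3 + E * F) + G * E) (W * (E ^ 2 + F)) (F * (W * (E ^ 2 + F)))
        (W * (E ^ 3 + E * F) + G * E - (D + D ^ 3 * F))) := by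
  set Γ := W * (E ^ 3 + E * F) + G * E with hΓ
  set Δ := W * (E ^ 2 + F) with hΔ
  have heg : E * G = 0 := mul_inv_eq_zero_of_mul_sq hf h₁
  have hd3 : D ^ 3 * E = D ^ 2 := he.inv_pow_mul 1
  have hd2 : D ^ 2 * E = D := he.inv_eq_sq_mul
  have hED2 : E * D ^ 2 = D := he.inv_eq_mul_sq
  have hd2e2 : D ^ 2 * E ^ 2 = E * D := by rw [sq E, ← mul_assoc, hd2, he.1]
  have hDE2 : D * E ^ 2 = E ^ 2 * D := ((show Commute E D from he.1).pow_left 2).eq.symm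
  have hDE3 : D * E ^ 3 = E ^ 3 * D := ((show Commute E D from he.1).pow_left 3).eq.symm
  have hefd : E * F * D = 0 := by rw [← hED2, ← mul_assoc, h₂, zero_mul]
  have hEΔ : E * Δ = D + D ^ 3 * F := by
    rw [hΔ, ← mul_assoc, hw, mul_add, sq, ← mul_assoc, hd3, hd2]
  have hEΓ : E * Γ = E * D + D ^ 2 * F := by
    rw [hΓ, mul_add, ← mul_assoc, hw, ← mul_assoc, heg, zero_mul, add_zero, mul_add, ← mul_assoc,
      hd3, pow_succ' E 2, ← mul_assoc, hd3, hd2e2]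
  have hEFΔ : E * F * Δ = 0 := by rw [hΔ, ← mul_assoc, hefw, zero_mul]
  have hEFΓ : E * F * Γ = 0 := by
    rw [hΓ, mul_add, ← mul_assoc, hefw, zero_mul, ← mul_assoc, mul_assoc E, hf.1, ← mul_assoc E,
      heg, zero_mul, zero_mul, add_zero]
  -- The two top blocks of `X * M * X = X` are this identity at `Z = E ^ 2 + F` and `Z = E ^ 3 + E *
  -- F`.
  have hWmul : ∀ Z : Matrix m m ℂ,
      W * Z = W * (E * (D * Z)) + F * G * (W * Z) + G * (D ^ 2 * Z) := by
    intro Z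
    conv_lhs => rw [hW]
    noncomm_ring
  have key12 : Γ * Γ + Δ * (F * Δ) = Δ := by
    have e1 : Γ * Γ = W * (E * E * (E * Γ) + E * F * Γ) + G * (E * Γ) := by
      nth_rewrite 1 [hΓ]
      noncomm_ring
    have e2 : Δ * (F * Δ) = W * (E * (E * F * Δ)) + W * F ^ 2 * Δ := by
      nth_rewrite 1 [hΔ]
      noncomm_ring
    have e3 : E * E * (E * D + D ^ 2 * F) = E * (D * (E ^ 2 + F)) := by
      rw [mul_add, mul_add D, hDE2, mul_assoc E E (D ^ 2 * F), ← mul_assoc E (D ^ 2), hED2]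
      noncomm_ring
    have e4 : D ^ 2 * (E ^ 2 + F) = E * D + D ^ 2 * F := by rw [mul_add, hd2e2]
    have e5 := hWmul (E ^ 2 + F)
    rw [← hΔ, e4, ← e3] at e5
    rw [e1, e2, hEFΓ, hEFΔ, hw2, hEΓ, add_zero, mul_zero, mul_zero, zero_add]
    conv_rhs => rw [e5]
    abel
  have key11 : Γ * (E * Γ + F * Δ) + Δ * (F * Γ) = Γ := by
    have e1 : Γ * (E * D + D ^ 2 * F + F * Δ) = W * (E * (E ^ 3 * D + E * (E * D ^ 2) * F)
        + E * (E * (E * F * Δ)) + E * F * E * D + E * F * D * D * F + E * F ^ 2 * Δ)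
        + G * (E * E * D + E * D ^ 2 * F + E * F * Δ) := by
      nth_rewrite 1 [hΓ]
      noncomm_ring
    have e2 : Δ * (F * Γ) = W * (E * (E * F * Γ)) + W * F ^ 2 * Γ := by
      nth_rewrite 1 [hΔ]
      noncomm_ring
    have e3 : D * (E ^ 3 + E * F) = E ^ 3 * D + E * D * F := by
      rw [mul_add, hDE3, ← mul_assoc D, ← he.1]
    have e4 : D ^ 2 * (E ^ 3 + E * F) = E * E * D + D * F := by
      rw [mul_add, ← mul_assoc, hd2, pow_succ E 2, ← mul_assoc, hd2e2, mul_assoc E D, ← he.1,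
        mul_assoc]
    have e5 := hWmul (E ^ 3 + E * F)
    rw [e3, e4] at e5
    have e6 : F * G * (G * E) = G * E := by
      rw [← mul_assoc, mul_assoc F, ← sq, hf.inv_eq_mul_sq]
    have e7 : F * G * Γ = F * G * (W * (E ^ 3 + E * F)) + G * E := by
      nth_rewrite 1 [hΓ]
      rw [mul_add, e6]
    rw [hEΓ, e1, e2, hEFΓ, hEFΔ, hw2, h₂, hefd, h₁, hED2, e7, hΓ]
    simp only [mul_zero, zero_mul, add_zero, zero_add]
    conv_rhs => rw [e5]
    abel
  have hFW : F * W = W * E ^ 2 - (D ^ 2 - G) := by rw [← hsyl]; abel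
  -- The Sylvester equation enters here, moving `F` past `W`. Of the four blocks of commutation only
  -- the two left ones need work; the right ones follow from `hEΔ` and the choice of bottom row.
  have hcomm₁₁ : Γ * E + Δ * F = E * Γ + F * Δ := by
    have e1 : F * Δ = (W * E ^ 2 - (D ^ 2 - G)) * (E ^ 2 + F) := by
      rw [← hFW, hΔ]; noncomm_ring
    have e2 : (W * E ^ 2 - (D ^ 2 - G)) * (E ^ 2 + F) = W * E ^ 4 + W * E ^ 2 * F - D ^ 2 * E ^ 2
        - D ^ 2 * F + G * E ^ 2 + G * F := by noncomm_ring
    have e3 : Γ * E + Δ * F = W * E ^ 4 + W * (E * F * E) + G * E ^ 2 + W * E ^ 2 * F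
        + W * F ^ 2 := by rw [hΓ, hΔ]; noncomm_ring
    rw [e1, e2, e3, hEΓ, hd2e2, h₂, hw2, hf.1]
    noncomm_ring
  have hcomm₂₁ : F * Γ = F * Δ * E + (Γ - (D + D ^ 3 * F)) * F := by
    have e1 : F * Γ = F * W * E ^ 3 + F * W * (E * F) + F * G * E := by
      rw [hΓ]; noncomm_ring
    have e2 : F * Δ * E = F * W * E ^ 3 + F * (W * (F * E)) := by rw [hΔ]; noncomm_ring
    have e3 : Γ * F = W * E ^ 3 * F + W * (E * F ^ 2) + G * E * F := by rw [hΓ]; noncomm_ring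
    have e4 : D ^ 3 * F * F = 0 := by
      rw [← he.inv_pow_mul 2, mul_assoc, mul_assoc, ← sq, h₁, mul_zero]
    have e5 : (W * E ^ 2 - (D ^ 2 - G)) * (E * F) = W * E ^ 3 * F - D ^ 2 * E * F + G * E * F := by
      noncomm_ring
    have e6 : F * W * (E * F) = W * E ^ 3 * F - D * F + G * E * F := by
      rw [hFW, e5, hd2]
    rw [e1, e6, sub_mul, e2, hw3, e3, h₁, add_mul, e4]
    noncomm_ring
  set M : Matrix (m ⊕ m) (m ⊕ m) ℂ := fromBlocks E 1 F 0 with hM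
  set X := fromBlocks Γ Δ (F * Δ) (Γ - (D + D ^ 3 * F)) with hX
  have hMX : M * X = fromBlocks (E * Γ + F * Δ) Γ (F * Γ) (F * Δ) := by
    rw [hM, hX, fromBlocks_multiply, hEΔ]
    simp
  have hXM : X * M = M * X := by
    rw [hMX, hM, hX, fromBlocks_multiply, hcomm₁₁, ← hcomm₂₁]
    simp
  have hc : Commute M X := hXM.symm
  have hXMX : X = X * M * X := by
    have e1 : X * (M * X) = fromBlocks Γ Δ (F * Δ * (E * Γ + F * Δ) + (Γ - (D + D ^ 3 * F)) * (F * Γ))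
        (F * Δ * Γ + (Γ - (D + D ^ 3 * F)) * (F * Δ)) := by
      rw [hMX, hX, fromBlocks_multiply, key11, key12]
    have e2 : Commute M (X * (M * X)) := hc.mul_right ((Commute.refl M).mul_right hc)
    rw [e1] at e2
    rw [mul_assoc, e1]
    exact fromBlocks_eq_of_commute hc e2
  refine ⟨s + 2 * t + 4, hc, hXMX, ?_⟩
  set N : ℕ → Matrix (m ⊕ m) (m ⊕ m) ℂ := fun k => M ^ k * (1 - M * X) with hN
  have hNs : ∀ k, N (k + 1) = M * N k := fun k => by
    simp only [hN, pow_succ', mul_assoc]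
  have hXN : ∀ k, X * N k = 0 := fun k => by
    simp only [hN]
    rw [← mul_assoc, ← (hc.pow_left k).eq, mul_assoc, mul_sub, mul_one, ← mul_assoc X, ← hXMX,
      sub_self, mul_zero]
  have hblocks : ∀ k, N (k + 1) = fromBlocks
      (E * (N k).toBlocks₁₁ + (N k).toBlocks₂₁) (E * (N k).toBlocks₁₂ + (N k).toBlocks₂₂)
      (F * (N k).toBlocks₁₁) (F * (N k).toBlocks₁₂) := fun k => by
    rw [hNs]
    conv_lhs => rw [← fromBlocks_toBlocks (N k), hM, fromBlocks_multiply]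
    simp
  have hzero : ∀ k, Γ * (N k).toBlocks₁₁ + Δ * (N k).toBlocks₂₁ = 0
      ∧ Γ * (N k).toBlocks₁₂ + Δ * (N k).toBlocks₂₂ = 0 := fun k => by
    have := hXN k
    rw [← fromBlocks_toBlocks (N k), hX, fromBlocks_multiply, ← fromBlocks_zero,
      fromBlocks_inj] at this
    exact ⟨this.1, this.2.1⟩
  have c1 := recurrence_eventually_zero (x := fun k => (N k).toBlocks₁₁)
    (y := fun k => (N k).toBlocks₂₁) he hf h₁ h₂ hw hw2 (fun k => by simp [hblocks])
    (fun k => by simp [hblocks]) (fun k => (hzero k).1)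
  have c2 := recurrence_eventually_zero (x := fun k => (N k).toBlocks₁₂)
    (y := fun k => (N k).toBlocks₂₂) he hf h₁ h₂ hw hw2 (fun k => by simp [hblocks])
    (fun k => by simp [hblocks]) (fun k => (hzero k).2)
  have hlast : N (s + 2 * t + 4) = 0 := by
    rw [← fromBlocks_toBlocks (N _), c1.1, c1.2, c2.1, c2.2, fromBlocks_zero]
  simp only [hN] at hlast
  rwa [mul_sub, mul_one, ← mul_assoc, ← pow_succ, sub_eq_zero] at hlast

end Blocks

/-! ### Passage to the least exponent, and reindexing of sums. -/

section Index

variable {m : Type*} [Fintype m] [DecidableEq m]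

theorem Matrix.isDrazinInverseWith_drazinIndex (A : Matrix m m ℂ) :
    IsDrazinInverseWith A A.drazinInv A.drazinIndex :=
  Nat.sInf_mem (s := {k : ℕ | IsDrazinInverseWith A A.drazinInv k}) A.isDrazinInverse_drazinInv

end Index

theorem Finset.sum_Icc_one_eq_sum_range {M : Type*} [AddCommMonoid M] (φ : ℕ → M) (k : ℕ) :
    ∑ i ∈ Finset.Icc 1 k, φ i = ∑ i ∈ Finset.range k, φ (i + 1) := by
  induction k with
  | zero => simp
  | succ k ih => rw [Finset.sum_Icc_succ_top (by omega), Finset.sum_range_succ, ih]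

/-! ### Expansion of the four blocks into explicit sums. -/

section Expansion

variable {R : Type*} [Ring R] {e f d g : R} {s t : ℕ}

theorem couplingLeft_eq_sum_Icc (j : ℕ) : couplingLeft f g d t j = (1 - f * g) * d ^ j
    + ∑ i ∈ Finset.Icc 1 t, f ^ i * (1 - f * g) * d ^ (2 * i + j) := by
  rw [couplingLeft, Finset.sum_range_succ', Finset.sum_Icc_one_eq_sum_range, add_comm]
  simp

theorem mul_couplingLeft (hf : IsDrazinInverseWith f g t) (j : ℕ) :
    f * couplingLeft f g d t j = f * (1 - f * g) * d ^ j
    + ∑ i ∈ Finset.Icc 1 (t - 1), f ^ (i + 1) * (1 - f * g) * d ^ (2 * i + j) := by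
  rw [couplingLeft, Finset.sum_range_succ, mul_add, ← mul_assoc f, ← mul_assoc f, ← pow_succ',
    hf.pow_mul_one_sub (Nat.le_succ t), zero_mul, add_zero, Finset.sum_Icc_one_eq_sum_range]
  -- For `t = 0` the truncated `t - 1` also gives an empty sum, and `f * (1 - f * g) = 0`.
  rcases t with _ | t
  · have := hf.pow_mul_one_sub (Nat.le_succ 0)
    rw [pow_one] at this
    simp [this]
  · rw [Finset.sum_range_succ', mul_add, Finset.mul_sum, add_comm]
    simp [← mul_assoc, ← pow_succ']

theorem couplingRight_eq_sum_Icc (j : ℕ) : couplingRight e d g s (j + 2) =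
    ∑ i ∈ Finset.Icc 1 (s / 2 + 1), g ^ (i + 1) * e ^ (2 * i + j) * (1 - e * d) := by
  rw [couplingRight, Finset.sum_Icc_one_eq_sum_range]
  refine Finset.sum_congr rfl fun i _ => ?_
  rw [show 2 * (i + 1) + j = 2 * i + (j + 2) by ring]

theorem couplingLeft_eq_add_mul (hf : IsDrazinInverseWith f g t) (j : ℕ) :
    couplingLeft f g d t j = (1 - f * g) * d ^ j + f * couplingLeft f g d t (j + 2) := by
  rw [couplingLeft, couplingLeft, Finset.sum_range_succ', Finset.sum_range_succ, mul_add,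
    ← mul_assoc f, ← mul_assoc f, ← pow_succ', hf.pow_mul_one_sub (Nat.le_succ t), zero_mul,
    add_zero, Finset.mul_sum, add_comm]
  simp only [← mul_assoc, ← pow_succ']
  have : ∀ i, 2 * (i + 1) + j = 2 * i + (j + 2) := fun i => by ring
  simp [this]

theorem couplingRight_eq_add (he : IsDrazinInverseWith e d s) (j : ℕ) :
    couplingRight e d g s j = g ^ 2 * e ^ j * (1 - e * d) + g * couplingRight e d g s (j + 2) := by
  rw [couplingRight, couplingRight, Finset.sum_range_succ', Finset.sum_range_succ, mul_add,
    mul_assoc (g ^ (s / 2 + 2)), he.pow_mul_one_sub (by omega), mul_zero, mul_zero, mul_zero,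
    add_zero, Finset.mul_sum, add_comm]
  simp only [← mul_assoc, ← pow_succ']
  have : ∀ i, 2 * (i + 1) + j = 2 * i + (j + 2) := fun i => by ring
  have h' : ∀ i, i + 1 + 2 = i + 2 + 1 := fun i => by ring
  simp [this, h']

theorem mul_couplingRight_eq_sum_Icc (hf : IsDrazinInverseWith f g t) (j : ℕ) :
    f * couplingRight e d g s (j + 1)
      = ∑ i ∈ Finset.Icc 1 (s / 2 + 1), g ^ i * e ^ (2 * i + j - 1) * (1 - e * d) := by
  rw [couplingRight, Finset.sum_Icc_one_eq_sum_range, Finset.mul_sum]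
  refine Finset.sum_congr rfl fun i _ => ?_
  rw [show 2 * (i + 1) + j - 1 = 2 * i + (j + 1) by omega, ← mul_assoc, ← mul_assoc,
    hf.mul_inv_pow]

/-- The finite sums `∑ g ^ (i + a) e ^ (2 i + j) (1 - e d)` stabilize. -/
theorem sum_Icc_eq_sum_Icc (he : IsDrazinInverseWith e d s) (a j k l : ℕ)
    (hkl : k ≤ l) (hs : s ≤ 2 * (k + 1) + j) :
    ∑ i ∈ Finset.Icc 1 l, g ^ (i + a) * e ^ (2 * i + j) * (1 - e * d)
      = ∑ i ∈ Finset.Icc 1 k, g ^ (i + a) * e ^ (2 * i + j) * (1 - e * d) := by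
  symm
  refine Finset.sum_subset (Finset.Icc_subset_Icc_right hkl) fun i _ hi => ?_
  simp only [Finset.mem_Icc] at *
  rw [mul_assoc, he.pow_mul_one_sub (by omega), mul_zero]

/-- The upper limits in the formula differ from block to block; since all further terms vanish, both
sums may be compared through the common limit `k + s + 1`. -/
theorem sum_Icc_eq_pow_mul_couplingRight (he : IsDrazinInverseWith e d s) (a j k : ℕ)
    (hs : s ≤ 2 * (k + 1) + j) :
    ∑ i ∈ Finset.Icc 1 k, g ^ (i + (a + 1)) * e ^ (2 * i + j) * (1 - e * d)
      = g ^ a * couplingRight e d g s (j + 2) := by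
  rw [← sum_Icc_eq_sum_Icc he _ _ k (k + s + 1) (by omega) hs,
    sum_Icc_eq_sum_Icc he _ _ (s / 2 + 1) (k + s + 1) (by omega) (by omega),
    couplingRight_eq_sum_Icc, Finset.mul_sum]
  refine Finset.sum_congr rfl fun i _ => ?_
  rw [← mul_assoc, ← mul_assoc, ← pow_add]
  congr 3
  ring

theorem coupling_mul_pow (he : IsDrazinInverseWith e d s) :
    coupling e f d g s t * e = couplingLeft f g d t 3 - g * d + couplingRight e d g s 1 ∧
    coupling e f d g s t * e ^ 2
      = couplingLeft f g d t 2 - g * d * e + couplingRight e d g s 2 ∧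
    coupling e f d g s t * e ^ 3
      = couplingLeft f g d t 1 - g * d * e ^ 2 + couplingRight e d g s 3 := by
  have h1 : coupling e f d g s t * e
      = couplingLeft f g d t 3 - g * d + couplingRight e d g s 1 := by
    rw [coupling, add_mul, sub_mul, couplingLeft_mul he 2, couplingRight_mul he, mul_assoc g,
      he.inv_eq_sq_mul]
  have h2 : coupling e f d g s t * e ^ 2
      = couplingLeft f g d t 2 - g * d * e + couplingRight e d g s 2 := by
    rw [sq, ← mul_assoc, h1, add_mul, sub_mul, couplingLeft_mul he 1, couplingRight_mul he]
  refine ⟨h1, h2, ?_⟩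
  rw [pow_succ, ← mul_assoc, h2, add_mul, sub_mul, couplingLeft_mul he 0, couplingRight_mul he, sq,
    ← mul_assoc]

variable (s t) in
theorem coupling_topLeft_eq (he : IsDrazinInverseWith e d s) :
    coupling e f d g s t * (e ^ 3 + e * f) + g * e =
      d + d ^ 3 * f - g * d * f - g ^ 2 * e ^ 2 * d * f - f * g * d + g * e * (1 - e * d)
      + g ^ 2 * e * f - f * g * d ^ 3 * f + g ^ 3 * e ^ 3 * (1 - e * d) * f
      + ∑ i ∈ Finset.Icc 1 t, f ^ i * (1 - f * g) * d ^ (2 * i + 1)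
      + ∑ i ∈ Finset.Icc 1 (s / 2), g ^ (i + 1) * e ^ (2 * i + 1) * (1 - e * d)
      + ∑ i ∈ Finset.Icc 1 t, f ^ i * (1 - f * g) * d ^ (2 * i + 3) * f
      + ∑ i ∈ Finset.Icc 1 (s / 2 - 1), g ^ (i + 3) * e ^ (2 * i + 3) * (1 - e * d) * f := by
  obtain ⟨w1, -, w3⟩ := coupling_mul_pow (f := f) (g := g) (t := t) he
  have l1 := couplingLeft_eq_sum_Icc (f := f) (g := g) (d := d) (t := t) 1
  have l3 := couplingLeft_eq_sum_Icc (f := f) (g := g) (d := d) (t := t) 3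
  have r1 : ∑ i ∈ Finset.Icc 1 (s / 2), g ^ (i + 1) * e ^ (2 * i + 1) * (1 - e * d)
      = g ^ 0 * couplingRight e d g s 3 :=
    sum_Icc_eq_pow_mul_couplingRight he 0 1 _ (by omega)
  have r2 : ∑ i ∈ Finset.Icc 1 (s / 2 - 1), g ^ (i + 3) * e ^ (2 * i + 3) * (1 - e * d)
      = g ^ 2 * couplingRight e d g s 5 :=
    sum_Icc_eq_pow_mul_couplingRight he 2 3 _ (by omega)
  have r3 := couplingRight_eq_add (g := g) he 1
  have r4 := couplingRight_eq_add (g := g) he 3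
  have hde : d * e ^ 2 = e * e * d := by rw [sq, ← mul_assoc, ← he.1, mul_assoc, ← he.1, mul_assoc]
  rw [← Finset.sum_mul _ _ f, ← Finset.sum_mul _ _ f, r1, r2, mul_add, ← mul_assoc _ e f, w1, w3, r3, r4,
    mul_assoc g d, hde, l1, l3]
  noncomm_ring

variable (s t) in
-- The factor `f` on the right meets the `i = 0` term of `couplingRight` at exponent zero, where `g
-- ^ 2 * f = g` supplies the leading part of `g * (1 - e * d)`.
theorem coupling_topRight_eq (he : IsDrazinInverseWith e d s) (hf : IsDrazinInverseWith f g t) :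
    coupling e f d g s t * (e ^ 2 + f) =
      d ^ 2 + d ^ 4 * f - g * d ^ 2 * f - g ^ 2 * e * d * f - f * g * d ^ 2
      + g * (1 - e * d) - f * g * d ^ 4 * f + g ^ 3 * e ^ 2 * (1 - e * d) * f
      + ∑ i ∈ Finset.Icc 1 t, f ^ i * (1 - f * g) * d ^ (2 * i + 2)
      + ∑ i ∈ Finset.Icc 1 (s / 2 + 1), g ^ (i + 1) * e ^ (2 * i) * (1 - e * d)
      + ∑ i ∈ Finset.Icc 1 t, f ^ i * (1 - f * g) * d ^ (2 * i + 4) * f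
      + ∑ i ∈ Finset.Icc 1 (s / 2), g ^ (i + 3) * e ^ (2 * i + 2) * (1 - e * d) * f := by
  obtain ⟨-, w2, -⟩ := coupling_mul_pow (f := f) (g := g) (t := t) he
  have l2 := couplingLeft_eq_sum_Icc (f := f) (g := g) (d := d) (t := t) 2
  have l4 := couplingLeft_eq_sum_Icc (f := f) (g := g) (d := d) (t := t) 4
  have r1 : ∑ i ∈ Finset.Icc 1 (s / 2 + 1), g ^ (i + 1) * e ^ (2 * i) * (1 - e * d)
      = couplingRight e d g s 2 := (couplingRight_eq_sum_Icc 0).symm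
  have r2 : ∑ i ∈ Finset.Icc 1 (s / 2), g ^ (i + 3) * e ^ (2 * i + 2) * (1 - e * d)
      = g ^ 2 * couplingRight e d g s 4 :=
    sum_Icc_eq_pow_mul_couplingRight he 2 2 _ (by omega)
  have r3 := couplingRight_eq_add (g := g) he 0
  have r4 := couplingRight_eq_add (g := g) he 2
  have hg : g ^ 2 * e ^ 0 * (1 - e * d) * f = g - g ^ 2 * e * d * f := by
    have : g ^ 2 * e ^ 0 * (1 - e * d) * f = g ^ 2 * f - g ^ 2 * e * d * f := by noncomm_ring
    rw [this, hf.inv_eq_sq_mul]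
  rw [← Finset.sum_mul _ _ f, ← Finset.sum_mul _ _ f, r1, r2, mul_add, w2, coupling, r3,
    add_mul _ _ f, add_mul _ _ f, hg, r4, l2, l4, mul_assoc g d, ← he.1]
  noncomm_ring

variable (s t) in
theorem coupling_bottomLeft_eq (he : IsDrazinInverseWith e d s) (hf : IsDrazinInverseWith f g t) :
    f * (coupling e f d g s t * (e ^ 2 + f)) =
      f * (1 - f * g) * d ^ 2 + f * g * (1 - e * d) + f * (1 - f * g) * d ^ 4 * f
      + g ^ 2 * e ^ 2 * (1 - e * d) * f - f * g * d ^ 2 * f - g * e * d * f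
      + ∑ i ∈ Finset.Icc 1 (t - 1), f ^ (i + 1) * (1 - f * g) * d ^ (2 * i + 2)
      + ∑ i ∈ Finset.Icc 1 (s / 2 + 1), g ^ i * e ^ (2 * i) * (1 - e * d)
      + ∑ i ∈ Finset.Icc 1 (t - 1), f ^ (i + 1) * (1 - f * g) * d ^ (2 * i + 4) * f
      + ∑ i ∈ Finset.Icc 1 (s / 2), g ^ (i + 2) * e ^ (2 * i + 2) * (1 - e * d) * f := by
  obtain ⟨-, w2, -⟩ := coupling_mul_pow (f := f) (g := g) (t := t) he
  have l2 := mul_couplingLeft (d := d) hf 2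
  have l4 := mul_couplingLeft (d := d) hf 4
  have r1 : ∑ i ∈ Finset.Icc 1 (s / 2 + 1), g ^ i * e ^ (2 * i) * (1 - e * d)
      = f * couplingRight e d g s 2 := (mul_couplingRight_eq_sum_Icc hf 1).symm
  have r2 : ∑ i ∈ Finset.Icc 1 (s / 2), g ^ (i + 2) * e ^ (2 * i + 2) * (1 - e * d)
      = g ^ 1 * couplingRight e d g s 4 :=
    sum_Icc_eq_pow_mul_couplingRight he 1 2 _ (by omega)
  have r3 : f * couplingRight e d g s 0 * f = f * g - g * e * d * f
      + g ^ 2 * e ^ 2 * (1 - e * d) * f + g * couplingRight e d g s 4 * f := by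
    have : f * (g ^ 2 * e ^ 0 * (1 - e * d)) = f * g ^ 2 * (1 - e * d) := by noncomm_ring
    rw [couplingRight_eq_add he 0, mul_add, ← mul_assoc f g, mul_mul_couplingRight hf,
      couplingRight_eq_add he (0 + 2), this, hf.inv_eq_mul_sq, hf.1]
    noncomm_ring
  have h : f * (coupling e f d g s t * (e ^ 2 + f)) = f * couplingLeft f g d t 2
      - f * g * (d * e) + f * couplingRight e d g s 2 + f * couplingLeft f g d t 4 * f
      - f * g * d ^ 2 * f + f * couplingRight e d g s 0 * f := by
    rw [mul_add, w2, coupling]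
    noncomm_ring
  rw [← Finset.sum_mul _ _ f, ← Finset.sum_mul _ _ f, r1, r2, h, r3, l2, l4, ← he.1]
  noncomm_ring

variable (s t) in
theorem coupling_bottomRight_eq (he : IsDrazinInverseWith e d s)
    (hf : IsDrazinInverseWith f g t) :
    coupling e f d g s t * (e ^ 3 + e * f) + g * e - (d + d ^ 3 * f) =
      -(f * g * d ^ 3 * f) - g * d * f + f * (1 - f * g) * d ^ 3 - f * g * d
      + f * (1 - f * g) * d ^ 5 * f - g ^ 2 * e ^ 2 * d * f + g ^ 2 * e * f
      + ∑ i ∈ Finset.Icc 1 (t - 1), f ^ (i + 1) * (1 - f * g) * d ^ (2 * i + 3)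
      + ∑ i ∈ Finset.Icc 1 (s / 2 + 1), g ^ i * e ^ (2 * i - 1) * (1 - e * d)
      + ∑ i ∈ Finset.Icc 1 (t - 1), f ^ (i + 1) * (1 - f * g) * d ^ (2 * i + 5) * f
      -- The sums in `f` begin one power later here, so one term is split off each `couplingLeft`;
      -- these account for the subtracted `d + d ^ 3 * f`.
      + ∑ i ∈ Finset.Icc 1 (s / 2), g ^ (i + 2) * e ^ (2 * i + 1) * (1 - e * d) * f := by
  obtain ⟨w1, -, w3⟩ := coupling_mul_pow (f := f) (g := g) (t := t) he
  have l1 := couplingLeft_eq_add_mul (d := d) hf 1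
  have l3 := couplingLeft_eq_add_mul (d := d) hf 3
  have l3' := mul_couplingLeft (d := d) hf 3
  have l5 := mul_couplingLeft (d := d) hf 5
  have r1 : ∑ i ∈ Finset.Icc 1 (s / 2 + 1), g ^ i * e ^ (2 * i - 1) * (1 - e * d)
      = g * e * (1 - e * d) + couplingRight e d g s 3 := by
    have : f * (g ^ 2 * e ^ 1 * (1 - e * d)) = f * g ^ 2 * (e * (1 - e * d)) := by noncomm_ring
    have h : f * couplingRight e d g s 1
        = ∑ i ∈ Finset.Icc 1 (s / 2 + 1), g ^ i * e ^ (2 * i - 1) * (1 - e * d) :=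
      mul_couplingRight_eq_sum_Icc hf 0
    rw [← h, couplingRight_eq_add he 1, mul_add, ← mul_assoc f g, mul_mul_couplingRight hf, this,
      hf.inv_eq_mul_sq, mul_assoc g e]
  have r2 : ∑ i ∈ Finset.Icc 1 (s / 2), g ^ (i + 2) * e ^ (2 * i + 1) * (1 - e * d)
      = g ^ 1 * couplingRight e d g s 3 :=
    sum_Icc_eq_pow_mul_couplingRight he 1 1 _ (by omega)
  have r3 := couplingRight_eq_add (g := g) he 1
  have hde : d * e ^ 2 = e * e * d := by rw [sq, ← mul_assoc, ← he.1, mul_assoc, ← he.1, mul_assoc]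
  have h : coupling e f d g s t * (e ^ 3 + e * f) + g * e - (d + d ^ 3 * f)
      = couplingLeft f g d t 1 - d - g * (d * e ^ 2) + couplingRight e d g s 3
        + (couplingLeft f g d t 3 - d ^ 3 - g * d + couplingRight e d g s 1) * f + g * e := by
    rw [mul_add, ← mul_assoc _ e f, w1, w3]
    noncomm_ring
  rw [← Finset.sum_mul _ _ f, ← Finset.sum_mul _ _ f, r1, r2, h, hde, l1, l3', l3, l5, r3]
  noncomm_ring

end Expansion

theorem corollary2p4 (n : ℕ) (E F : Matrix (Fin n) (Fin n) ℂ)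
    (h₁ : E * F ^ 2 = 0) (h₂ : E * F * E = 0) :
    let Ed := E.drazinInv
    let Fd := F.drazinInv
    let Ep := E.drazinPi
    let Fp := F.drazinPi
    let s := E.drazinIndex
    let t := F.drazinIndex
    let Γ : Matrix (Fin n) (Fin n) ℂ :=
      Ed + Ed ^ 3 * F - Fd * Ed * F - Fd ^ 2 * E ^ 2 * Ed * F - F * Fd * Ed + Fd * E * Ep
      + Fd ^ 2 * E * F - F * Fd * Ed ^ 3 * F + Fd ^ 3 * E ^ 3 * Ep * F
      + ∑ i ∈ Finset.Icc 1 t, F ^ i * Fp * Ed ^ (2 * i + 1)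
      + ∑ i ∈ Finset.Icc 1 (s / 2), Fd ^ (i + 1) * E ^ (2 * i + 1) * Ep
      + ∑ i ∈ Finset.Icc 1 t, F ^ i * Fp * Ed ^ (2 * i + 3) * F
      + ∑ i ∈ Finset.Icc 1 (s / 2 - 1), Fd ^ (i + 3) * E ^ (2 * i + 3) * Ep * F
    let Δ : Matrix (Fin n) (Fin n) ℂ :=
      Ed ^ 2 + Ed ^ 4 * F - Fd * Ed ^ 2 * F - Fd ^ 2 * E * Ed * F - F * Fd * Ed ^ 2
      + Fd * Ep - F * Fd * Ed ^ 4 * F + Fd ^ 3 * E ^ 2 * Ep * F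
      + ∑ i ∈ Finset.Icc 1 t, F ^ i * Fp * Ed ^ (2 * i + 2)
      + ∑ i ∈ Finset.Icc 1 (s / 2 + 1), Fd ^ (i + 1) * E ^ (2 * i) * Ep
      + ∑ i ∈ Finset.Icc 1 t, F ^ i * Fp * Ed ^ (2 * i + 4) * F
      + ∑ i ∈ Finset.Icc 1 (s / 2), Fd ^ (i + 3) * E ^ (2 * i + 2) * Ep * F
    let Λ : Matrix (Fin n) (Fin n) ℂ :=
      F * Fp * Ed ^ 2 + F * Fd * Ep + F * Fp * Ed ^ 4 * F + Fd ^ 2 * E ^ 2 * Ep * F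
      - F * Fd * Ed ^ 2 * F - Fd * E * Ed * F
      + ∑ i ∈ Finset.Icc 1 (t - 1), F ^ (i + 1) * Fp * Ed ^ (2 * i + 2)
      + ∑ i ∈ Finset.Icc 1 (s / 2 + 1), Fd ^ i * E ^ (2 * i) * Ep
      + ∑ i ∈ Finset.Icc 1 (t - 1), F ^ (i + 1) * Fp * Ed ^ (2 * i + 4) * F
      + ∑ i ∈ Finset.Icc 1 (s / 2), Fd ^ (i + 2) * E ^ (2 * i + 2) * Ep * F
    let Ξ : Matrix (Fin n) (Fin n) ℂ :=
      -(F * Fd * Ed ^ 3 * F) - Fd * Ed * F + F * Fp * Ed ^ 3 - F * Fd * Ed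
      + F * Fp * Ed ^ 5 * F - Fd ^ 2 * E ^ 2 * Ed * F + Fd ^ 2 * E * F
      + ∑ i ∈ Finset.Icc 1 (t - 1), F ^ (i + 1) * Fp * Ed ^ (2 * i + 3)
      + ∑ i ∈ Finset.Icc 1 (s / 2 + 1), Fd ^ i * E ^ (2 * i - 1) * Ep
      + ∑ i ∈ Finset.Icc 1 (t - 1), F ^ (i + 1) * Fp * Ed ^ (2 * i + 5) * F
      + ∑ i ∈ Finset.Icc 1 (s / 2), Fd ^ (i + 2) * E ^ (2 * i + 1) * Ep * F
    (Matrix.fromBlocks E 1 F 0).drazinInv = Matrix.fromBlocks Γ Δ Λ Ξ := by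
  intro Ed Fd Ep Fp s t Γ Δ Λ Ξ
  have he : IsDrazinInverseWith E Ed s := E.isDrazinInverseWith_drazinIndex
  have hf : IsDrazinInverseWith F Fd t := F.isDrazinInverseWith_drazinIndex
  have key := isDrazinInverse_fromBlocks_of_coupling he hf h₁ h₂ (mul_coupling he hf h₁ h₂)
    (mul_mul_coupling he hf h₁ h₂) (coupling_mul_sq he hf h₁) (coupling_mul_mul he hf h₂)
    (coupling_mul_sq_sub he hf) (coupling_eq he hf)
  rw [coupling_bottomRight_eq s t he hf, coupling_bottomLeft_eq s t he hf,
    coupling_topLeft_eq s t he, coupling_topRight_eq s t he hf] at key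
  exact (Matrix.fromBlocks E 1 F 0).isDrazinInverse_drazinInv.eq key
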